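/- Let $\mathbb{K}$ be a field of characteristic $0$ with algebraic closure $\overline{\mathbb{K}}$. For a commutative ring $R$, let $R^{\rm fr}[[t]]$ denote the ring of fractional power series $\sum_{n\ge 0} a_n t^{n/d}$, with $a_n\in R$ and some integer $d\ge 1$ depending on the series. For $\Phi(t,u)=\sum_{n\ge0} t^{n/d}\phi_n(u)\in\overline{\mathbb{K}}[u]^{\rm fr}[[t]]$ and $U\in\overline{\mathbb{K}}^{\rm fr}[[t]]$, put $\Phi(t,U)=\sum_{n\ge0} t^{n/d}\phi_n(U)\in\overline{\mathbb{K}}^{\rm fr}[[t]]$. We say that $U$ is a root of multiplicity $m$ of $\Phi$ if $\Phi(t,u)=(u-U)^m\Psi(t,u)$ for some $\Psi\in\overline{\mathbb{K}}[u]^{\rm fr}[[t]]$ with $\Psi(t,U)\neq0$. Let $k\ge 0$, let $P(x_0,x_1,\dots,x_k,t,v)$ be a polynomial with coefficients in $\mathbb{K}$ whose degree $n$ in $x_0$ is at least $2$, and let $P'_0=\partial P/\partial x_0$. Let $F(u)\equiv F(t,u)\in\mathbb{K}[u][[t]]$ and $F_1,\dots,F_k\in\mathbb{K}[[t]]$ satisfy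 $$P(F(u),F_1,\dots,F_k,t,u)=0.$$ Let $\Delta(x_1,\dots,x_k,t,v)$ be the discriminant of $P$ with respect to $x_0$ (the usual discriminant of a polynomial of degree $n$ in $x_0$, a polynomial in the coefficients of $P$). 1. Let $\ell\ge1$ and let $U\in\overline{\mathbb{K}}^{\rm fr}[[t]]$ be a root of multiplicity $\ell$ of $P'_0(F(u),F_1,\dots,F_k,t,u)$. Then, as a polynomial in $v$ with coefficients in $\overline{\mathbb{K}}^{\rm fr}[[t]]$, $\Delta(F_1,\dots,F_k,t,v)$ admits $U$ as a root of multiplicity at least $2\ell$, that is, it is divisible by $(v-U)^{2\ell}$. In other words, for $0\le i\le 2\ell-1$, $$\frac{\partial^i\Delta}{\partial v^i}(F_1,\dots,F_k,t,U)=0.$$ 2. Consequently, if $U_1,\dots,U_k\in\overline{\mathbb{K}}^{\rm fr}[[t]]$ (for instance, $k$ distinct series) satisfy $P'_0(F(U_i),F_1,\dots,F_k,t,U_i)=0$ for $1\le i\le k$, then the following $2k$ equations, which do not involve the series $F(U_i)$, hold: $$\Delta(F_1,\dots,F_k,t,U_i)=0,\qquad \frac{\partial\Delta}{\partial v}(F_1,\dots,F_k,t,U_i)=0\qquad(1\le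 i\le k).$$ -/

import Mathlib

noncomputable section

open Polynomial

/-- The additive monoid `(1/d) ℕ` of rational exponents `n / d`, `n ≥ 0`. -/
def fracExp (d : ℕ) : AddSubmonoid ℚ where
  carrier := {q | ∃ n : ℕ, q = (n : ℚ) / d}
  zero_mem' := ⟨0, by simp⟩
  add_mem' := by
    rintro _ _ ⟨m, rfl⟩ ⟨n, rfl⟩
    exact ⟨m + n, by push_cast; ring⟩

theorem fracExp_le_mul_right (d : ℕ) {e : ℕ} (he : 0 < e) : fracExp d ≤ fracExp (d * e) := by
  rintro _ ⟨n, rfl⟩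
  refine ⟨n * e, ?_⟩
  have : (e : ℚ) ≠ 0 := by positivity
  push_cast
  rw [mul_div_mul_right _ _ this]

theorem fracExp_le_mul_left (d : ℕ) {e : ℕ} (he : 0 < e) : fracExp d ≤ fracExp (e * d) := by
  rw [mul_comm]
  exact fracExp_le_mul_right d he

theorem fracExp_isPWO (d : ℕ) : (fracExp d : Set ℚ).IsPWO := by
  have h : (fracExp d : Set ℚ) = (fun n : ℕ => (n : ℚ) / d) '' Set.univ := by
    ext q
    constructor
    · rintro ⟨n, rfl⟩
      exact ⟨n, trivial, rfl⟩
    · rintro ⟨n, -, rfl⟩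
      exact ⟨n, rfl⟩
  rw [h]
  refine Set.IsPWO.image_of_monotone (Set.isWF_univ_iff.2 inferInstance).isPWO ?_
  intro a b hab
  simp only
  gcongr

theorem fracExp_finite_le {d : ℕ} (hd : 0 < d) (q : ℚ) :
    {p : ℚ | p ∈ fracExp d ∧ p ≤ q}.Finite := by
  have hd' : (0 : ℚ) < d := by exact_mod_cast hd
  refine ((Set.finite_Iic ⌊q * d⌋₊).image (fun n : ℕ => (n : ℚ) / d)).subset ?_
  rintro _ ⟨⟨n, rfl⟩, hn⟩
  exact ⟨n, Nat.le_floor ((div_le_iff₀ hd').1 hn), rfl⟩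

section

variable (R : Type*) [CommRing R]

/-- `R[[t^{1/d}]]`: series in `t` whose exponents all lie in `(1/d) ℕ`. -/
def FracLevel (d : ℕ) : Subring (HahnSeries ℚ R) where
  carrier := {f | f.support ⊆ fracExp d}
  zero_mem' := by simp
  one_mem' := by
    intro q hq
    have h : q = 0 := HahnSeries.support_single_subset hq
    rw [h]
    exact (fracExp d).zero_mem
  add_mem' := by
    intro f g hf hg
    exact (HahnSeries.support_add_subset f g).trans (Set.union_subset hf hg)
  neg_mem' := by
    intro f hf
    simpa using hf
  mul_mem' := by
    intro f g hf hg q hq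
    obtain ⟨a, ha, b, hb, rfl⟩ := HahnSeries.support_mul_subset hq
    exact (fracExp d).add_mem (hf ha) (hg hb)

/-- The ring `R^fr[[t]]` of fractional power series in `t` with coefficients in `R`: the series
`∑_{n ≥ 0} a_n t^{n/d}` for some integer `d ≥ 1` (depending on the series). -/
def FracPowerSeries : Subring (HahnSeries ℚ R) where
  carrier := {f | ∃ d : ℕ, 0 < d ∧ f ∈ FracLevel R d}
  zero_mem' := ⟨1, one_pos, zero_mem _⟩
  one_mem' := ⟨1, one_pos, one_mem _⟩
  add_mem' := by
    rintro f g ⟨d, hd, hf⟩ ⟨e, he, hg⟩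
    exact ⟨d * e, Nat.mul_pos hd he, add_mem
      (S := Subring (HahnSeries ℚ R)) (s := FracLevel R (d * e))
      (Set.Subset.trans hf (fracExp_le_mul_right d he))
      (Set.Subset.trans hg (fracExp_le_mul_left e hd))⟩
  neg_mem' := by
    rintro f ⟨d, hd, hf⟩
    exact ⟨d, hd, neg_mem hf⟩
  mul_mem' := by
    rintro f g ⟨d, hd, hf⟩ ⟨e, he, hg⟩
    exact ⟨d * e, Nat.mul_pos hd he, mul_mem
      (S := Subring (HahnSeries ℚ R)) (s := FracLevel R (d * e))
      (Set.Subset.trans hf (fracExp_le_mul_right d he))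
      (Set.Subset.trans hg (fracExp_le_mul_left e hd))⟩

end

section

variable {R S : Type*} [CommRing R] [CommRing S]

theorem fracLevel_single {d : ℕ} {q : ℚ} (hq : q ∈ fracExp d) (r : R) :
    HahnSeries.single q r ∈ FracLevel R d := by
  intro p hp
  have h : p = q := HahnSeries.support_single_subset hp
  rwa [h]

/-- The inclusion `R ⊆ R^fr[[t]]` of constants. -/
def fracC : R →+* FracPowerSeries R :=
  (HahnSeries.C : R →+* HahnSeries ℚ R).codRestrict (FracPowerSeries R)
    (fun r => ⟨1, one_pos, fracLevel_single (fracExp 1).zero_mem r⟩)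

/-- The inclusion `R[[t]] ⊆ R^fr[[t]]`. -/
def fracOfPowerSeries : PowerSeries R →+* FracPowerSeries R :=
  (HahnSeries.ofPowerSeries ℚ R).codRestrict (FracPowerSeries R) (fun f => by
    refine ⟨1, one_pos, ?_⟩
    intro q hq
    rw [HahnSeries.ofPowerSeries_apply] at hq
    obtain ⟨n, -, rfl⟩ := HahnSeries.support_embDomain_subset hq
    exact ⟨n, by simp⟩)

/-- The map `R^fr[[t]] → S^fr[[t]]` applying `f : R → S` to every coefficient. -/
def fracMap (f : R →+* S) (a : FracPowerSeries R) : FracPowerSeries S :=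
  ⟨HahnSeries.map (a : HahnSeries ℚ R) f, by
    obtain ⟨d, hd, h⟩ := a.2
    refine ⟨d, hd, fun q hq => h fun h0 => hq ?_⟩
    simp [h0]⟩

/-- The value at `u = U` of a polynomial `φ(u)` with coefficients in `R`. -/
def fracEval (U : FracPowerSeries R) (φ : R[X]) : FracPowerSeries R :=
  φ.eval₂ fracC U

theorem fracEval_mem_level {d : ℕ} {U : FracPowerSeries R}
    (hU : (U : HahnSeries ℚ R) ∈ FracLevel R d) (φ : R[X]) :
    (fracEval U φ : HahnSeries ℚ R) ∈ FracLevel R d := by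
  have h : (fracEval U φ : HahnSeries ℚ R) = φ.sum fun n a =>
      HahnSeries.C a * (U : HahnSeries ℚ R) ^ n := by
    unfold fracEval
    rw [eval₂_eq_sum, Polynomial.sum, Polynomial.sum]
    push_cast
    rfl
  rw [h]
  exact sum_mem fun n _ => mul_mem (fracLevel_single (fracExp d).zero_mem _) (pow_mem hU n)

theorem substTerm_mem_level {d e : ℕ} (hd : 0 < d) (he : 0 < e) {U : FracPowerSeries R}
    {Φ : FracPowerSeries R[X]} (hU : (U : HahnSeries ℚ R) ∈ FracLevel R d)
    (hΦ : (Φ : HahnSeries ℚ R[X]) ∈ FracLevel R[X] e) (p : ℚ) :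
    HahnSeries.single p (1 : R) *
      (fracEval U ((Φ : HahnSeries ℚ R[X]).coeff p) : HahnSeries ℚ R) ∈ FracLevel R (d * e) := by
  by_cases hp : (Φ : HahnSeries ℚ R[X]).coeff p = 0
  · simp [hp, fracEval]
  · exact mul_mem (fracLevel_single (fracExp_le_mul_left e hd (hΦ hp)) 1)
      (Set.Subset.trans (fracEval_mem_level hU _) (fracExp_le_mul_right d he))

theorem substTerm_coeff_ne_zero {d e : ℕ} {U : FracPowerSeries R}
    {Φ : FracPowerSeries R[X]} (hU : (U : HahnSeries ℚ R) ∈ FracLevel R d)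
    (hΦ : (Φ : HahnSeries ℚ R[X]) ∈ FracLevel R[X] e) {p q : ℚ}
    (h : (HahnSeries.single p (1 : R) *
      (fracEval U ((Φ : HahnSeries ℚ R[X]).coeff p) : HahnSeries ℚ R)).coeff q ≠ 0) :
    p ∈ fracExp e ∧ p ≤ q := by
  constructor
  · have hp : (Φ : HahnSeries ℚ R[X]).coeff p ≠ 0 := by
      intro h0
      rw [h0] at h
      simp [fracEval] at h
    exact hΦ hp
  · obtain ⟨a, ha, b, hb, hab⟩ := HahnSeries.support_mul_subset h
    have ha' : a = p := HahnSeries.support_single_subset ha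
    obtain ⟨n, hn⟩ := fracEval_mem_level hU _ hb
    have hb0 : 0 ≤ b := by rw [hn]; positivity
    have hab' : a + b = q := hab
    linarith

/-- The family of terms `t^p φ_p(U)`, for `Φ(t,u) = ∑_p t^p φ_p(u)`. -/
def substFamily (U : FracPowerSeries R) (Φ : FracPowerSeries R[X]) :
    HahnSeries.SummableFamily ℚ R ℚ where
  toFun p := HahnSeries.single p (1 : R) *
    (fracEval U ((Φ : HahnSeries ℚ R[X]).coeff p) : HahnSeries ℚ R)
  isPWO_iUnion_support' := by
    obtain ⟨d, hd, hU⟩ := U.2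
    obtain ⟨e, he, hΦ⟩ := Φ.2
    exact (fracExp_isPWO (d * e)).mono
      (Set.iUnion_subset fun p => substTerm_mem_level hd he hU hΦ p)
  finite_co_support' := by
    obtain ⟨d, hd, hU⟩ := U.2
    obtain ⟨e, he, hΦ⟩ := Φ.2
    intro q
    exact (fracExp_finite_le he q).subset fun p hp => substTerm_coeff_ne_zero hU hΦ hp

/-- The substitution `Φ(t,U) = ∑_p t^p φ_p(U)` of `U ∈ R^fr[[t]]` for `u` in
`Φ(t,u) = ∑_p t^p φ_p(u) ∈ R[u]^fr[[t]]`. -/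
def fracSubst (U : FracPowerSeries R) (Φ : FracPowerSeries R[X]) : FracPowerSeries R :=
  ⟨(substFamily U Φ).hsum, by
    obtain ⟨d, hd, hU⟩ := U.2
    obtain ⟨e, he, hΦ⟩ := Φ.2
    refine ⟨d * e, Nat.mul_pos hd he, fun q hq => ?_⟩
    by_contra hq'
    refine hq ?_
    rw [HahnSeries.SummableFamily.coeff_hsum]
    refine finsum_eq_zero_of_forall_eq_zero fun p => ?_
    by_contra h
    exact hq' (substTerm_mem_level hd he hU hΦ p h)⟩

/-- `U ∈ R^fr[[t]]` is a root of multiplicity `m` of `Φ(t,u) ∈ R[u]^fr[[t]]`: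
`Φ(t,u) = (u - U)^m Ψ(t,u)` with `Ψ(t,u) ∈ R[u]^fr[[t]]` and `Ψ(t,U) ≠ 0`. -/
def IsRootOfMultiplicity (U : FracPowerSeries R) (m : ℕ) (Φ : FracPowerSeries R[X]) : Prop :=
  ∃ Ψ : FracPowerSeries R[X],
    Φ = (fracC (X : R[X]) - fracMap (C : R →+* R[X]) U) ^ m * Ψ ∧ fracSubst U Ψ ≠ 0

end

/-- The tuple `(x_1, …, x_k, t, v)`. -/
def paramPoint {A : Type*} {k : ℕ} (x : Fin k → A) (t v : A) : Fin (k + 2) → A :=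
  Fin.snoc (Fin.snoc x t : Fin (k + 1) → A) v

/-- The tuple `(x_0, x_1, …, x_k, t, v)`. -/
def fullPoint {A : Type*} {k : ℕ} (x₀ : A) (x : Fin k → A) (t v : A) : Fin (k + 3) → A :=
  Fin.cons x₀ (paramPoint x t v)

section

variable {K : Type*} [Field K] {k : ℕ}

/-- For `Q(x_0, …, x_k, t, v)` with coefficients in `K`, `F ∈ K[u][[t]]` and `F_i ∈ K[[t]]`, the
series `Q(F(u), F_1, …, F_k, t, u) ∈ K[u][[t]]`. -/
def evalSeries (Q : MvPolynomial (Fin (k + 3)) K) (F : PowerSeries K[X])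
    (Fs : Fin k → PowerSeries K) : PowerSeries K[X] :=
  Q.eval₂ ((PowerSeries.C).comp (C : K →+* K[X]))
    (fullPoint F (fun i => PowerSeries.map (C : K →+* K[X]) (Fs i)) PowerSeries.X
      (PowerSeries.C (X : K[X])))

/-- The discriminant `Δ(x_1, …, x_k, t, v)` of `P(x_0, x_1, …, x_k, t, v)` with respect to
`x_0`. -/
def discr₀ (P : MvPolynomial (Fin (k + 3)) K) : MvPolynomial (Fin (k + 2)) K :=
  (MvPolynomial.finSuccEquiv K (k + 2) P).discr

/-- The inclusion `K ⊆ K̄^fr[[t]]`. -/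
def constK : K →+* FracPowerSeries (AlgebraicClosure K) :=
  (fracC).comp (algebraMap K (AlgebraicClosure K))

/-- The inclusion `K[[t]] ⊆ K̄^fr[[t]]`. -/
def seriesK : PowerSeries K →+* FracPowerSeries (AlgebraicClosure K) :=
  (fracOfPowerSeries).comp (PowerSeries.map (algebraMap K (AlgebraicClosure K)))

/-- The inclusion `K[u][[t]] ⊆ K̄[u]^fr[[t]]`. -/
def seriesKu : PowerSeries K[X] →+* FracPowerSeries (AlgebraicClosure K)[X] :=
  (fracOfPowerSeries).comp (PowerSeries.map (mapRingHom (algebraMap K (AlgebraicClosure K))))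

/-- The value `Q(y, F_1, …, F_k, t, U) ∈ K̄^fr[[t]]`, for `y, U ∈ K̄^fr[[t]]`. -/
def evalFull (Q : MvPolynomial (Fin (k + 3)) K) (y : FracPowerSeries (AlgebraicClosure K))
    (Fs : Fin k → PowerSeries K) (U : FracPowerSeries (AlgebraicClosure K)) :
    FracPowerSeries (AlgebraicClosure K) :=
  Q.eval₂ constK (fullPoint y (fun i => seriesK (Fs i)) (seriesK PowerSeries.X) U)

/-- The value `D(F_1, …, F_k, t, U) ∈ K̄^fr[[t]]`, for `U ∈ K̄^fr[[t]]`. -/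
def evalParam (D : MvPolynomial (Fin (k + 2)) K) (Fs : Fin k → PowerSeries K)
    (U : FracPowerSeries (AlgebraicClosure K)) : FracPowerSeries (AlgebraicClosure K) :=
  D.eval₂ constK (paramPoint (fun i => seriesK (Fs i)) (seriesK PowerSeries.X) U)

/-- `D(F_1, …, F_k, t, v)` as a polynomial in `v` with coefficients in `K̄^fr[[t]]`. -/
def evalParamPoly (D : MvPolynomial (Fin (k + 2)) K) (Fs : Fin k → PowerSeries K) :
    (FracPowerSeries (AlgebraicClosure K))[X] :=
  D.eval₂ ((C).comp constK)
    (paramPoint (fun i => C (seriesK (Fs i))) (C (seriesK PowerSeries.X)) X)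

/-- The partial derivative `∂/∂v` of a polynomial in `x_1, …, x_k, t, v`. -/
def derivV (D : MvPolynomial (Fin (k + 2)) K) : MvPolynomial (Fin (k + 2)) K :=
  MvPolynomial.pderiv (Fin.last (k + 1)) D

end

end

/-!
If `f` has degree at least `2` and `f(a) = 0`, then `f'(a)²` divides the discriminant of `f`.
Indeed `disc f` lies in the ideal `(f'², f)`: the polynomial `f(x) - f(y)` has the root `x = y`, so
`disc ((x - y) h) = h(y)² disc h` shows that its discriminant is divisible by `f'(y)²`, while this
discriminant is congruent to `disc f` modulo `f(y)`.

Applied to `P` as a polynomial in `x₀` and to `a = F(u)`, this says that the square of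
`P'₀(F(u), F₁, …, F_k, t, u)` divides `Δ(F₁, …, F_k, t, u)` in `K̄[u]^fr[[t]]`. The Taylor expansion
at `u = U` is a ring homomorphism from `K̄[u]^fr[[t]]` to `K̄^fr[[t]][[ε]]`. If the first series is
divisible by `(u - U)^ℓ`, its expansion is divisible by `ε^ℓ` and that of `Δ(F₁, …, F_k, t, u)` by
`ε^{2ℓ}`; since `Δ(F₁, …, F_k, t, v)` is a polynomial in `v`, it is divisible by `(v - U)^{2ℓ}`.
-/

noncomputable section

open Polynomial

section Discriminant

variable {R S : Type*} [CommRing R] [CommRing S]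

theorem discr_map_of_natDegree_eq (φ : R →+* S) {f : R[X]}
    (h : (f.map φ).natDegree = f.natDegree) : (f.map φ).discr = φ f.discr := by
  let e : Fin ((f.map φ).natDegree - 1 + (f.map φ).natDegree) ≃
      Fin (f.natDegree - 1 + f.natDegree) := finCongr (by rw [h])
  have hmatrix : (f.map φ).sylvesterDeriv = (φ.mapMatrix f.sylvesterDeriv).submatrix e e := by
    ext i j
    by_cases hn : f.natDegree = 0
    · simp [sylvesterDeriv, hn, h]
    · simp [sylvesterDeriv, hn, h, Matrix.updateRow_apply, sylvester, Fin.ext_iff, e, Fin.addCases,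
        coeff_derivative, apply_ite φ, Fin.cast]
  rw [discr, discr, hmatrix, Matrix.det_submatrix_equiv_self, ← RingHom.map_det, h]
  simp

theorem dvd_discr_add_C_sub_discr (f : R[X]) (r : R) : r ∣ (f + C r).discr - f.discr := by
  let F : R[X][X] := f.map C + C X
  have hdeg : F.natDegree = f.natDegree := by
    rw [natDegree_add_C, natDegree_map_eq_of_injective C_injective]
  have heval (s : R) : F.map (evalRingHom s) = f + C s := by
    ext i
    simp [F, Polynomial.map_map]
  have hdiscr (s : R) : F.discr.eval s = (f + C s).discr := by
    rw [← heval s, discr_map_of_natDegree_eq _ (by rw [heval, hdeg, natDegree_add_C]),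
      coe_evalRingHom]
  simpa [hdiscr] using sub_dvd_eval_sub r 0 F.discr

theorem resultant_mul_right_of_natDegree_le {f g₁ g₂ : R[X]} {m n₁ n₂ : ℕ}
    (hf : f.natDegree ≤ m) (h₁ : g₁.natDegree = n₁) (h₂ : g₂.natDegree ≤ n₂) :
    resultant f (g₁ * g₂) m (n₁ + n₂) = resultant f g₁ m n₁ * resultant f g₂ m n₂ := by
  obtain ⟨c, rfl⟩ := Nat.exists_eq_add_of_le h₂
  subst h₁
  rw [← add_assoc, resultant_add_right_deg _ _ _ _ _ natDegree_mul_le,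
    resultant_mul_right _ _ _ _ hf, resultant_add_right_deg _ _ _ _ _ le_rfl]
  ring

theorem natDegree_X_sub_C_mul [Nontrivial R] (a : R) {h : R[X]} (hne : h ≠ 0) :
    ((X - C a) * h).natDegree = h.natDegree + 1 := by
  rw [(monic_X_sub_C a).natDegree_mul' hne, natDegree_X_sub_C, add_comm]

theorem resultant_derivative_X_sub_C_mul (a : R) {h : R[X]} {n : ℕ}
    (hdeg : h.natDegree = n + 1) :
    resultant ((X - C a) * h) (derivative ((X - C a) * h)) (n + 2) (n + 1) =
      (-1) ^ (n + 1) * h.eval a ^ 2 * resultant h h.derivative (n + 1) n := by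
  nontriviality R
  have hderiv : derivative ((X - C a) * h) = (X - C a) * h.derivative + h * 1 := by
    simp [derivative_mul, add_comm]
  have hdeg_h' : h.derivative.natDegree ≤ n := by
    have := natDegree_derivative_le h
    lia
  have hdeg_f' : (derivative ((X - C a) * h)).natDegree ≤ n + 1 := by
    have := natDegree_derivative_le ((X - C a) * h)
    rw [natDegree_X_sub_C_mul a (by rintro rfl; simp at hdeg)] at this
    lia
  calc resultant ((X - C a) * h) (derivative ((X - C a) * h)) (n + 2) (n + 1)
      = h.eval a * resultant h (derivative ((X - C a) * h)) (n + 1) (n + 1) := by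
        have hmul := resultant_mul_left (X - C a) h _ (n + 1) hdeg_f'
        rw [natDegree_X_sub_C, hdeg, add_comm 1, resultant_X_sub_C_left _ _ _ hdeg_f'] at hmul
        simpa [hderiv] using hmul
    _ = h.eval a * resultant h ((X - C a) * h.derivative) (n + 1) (1 + n) := by
        rw [hderiv, resultant_add_mul_right _ _ _ _ _ (by simp) hdeg.le, add_comm 1 n]
    _ = (-1) ^ (n + 1) * h.eval a ^ 2 * resultant h h.derivative (n + 1) n := by
        rw [resultant_mul_right_of_natDegree_le hdeg.le (natDegree_X_sub_C a) hdeg_h',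
          resultant_X_sub_C_right _ _ _ hdeg.le]
        ring

theorem discr_X_sub_C_mul_of_isRegular (a : R) {h : R[X]} (hpos : 0 < h.natDegree)
    (hreg : IsRegular h.leadingCoeff) :
    ((X - C a) * h).discr = h.eval a ^ 2 * h.discr := by
  nontriviality R
  obtain ⟨n, hn⟩ := Nat.exists_eq_add_of_le' (Nat.succ_le_of_lt hpos)
  have hf : ((X - C a) * h).natDegree = n + 2 := by
    rw [natDegree_X_sub_C_mul a (by rintro rfl; simp at hpos), hn]
  have hres_f := resultant_deriv (f := (X - C a) * h) (natDegree_pos_iff_degree_pos.1 (by lia))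
  have hres_h := resultant_deriv (natDegree_pos_iff_degree_pos.1 hpos)
  have hsign : (n + 2) * (n + 1) / 2 = (n + 1) * n / 2 + (n + 1) := by
    rw [← Nat.add_mul_div_right _ _ two_pos]
    ring_nf
  simp only [hf, hn, Nat.add_sub_cancel, Nat.reduceSubDiff,
    leadingCoeff_monic_mul (monic_X_sub_C a), resultant_derivative_X_sub_C_mul a hn,
    hsign] at hres_f hres_h
  rw [hres_h] at hres_f
  have hunit : IsUnit ((-1 : R) ^ ((n + 1) * n / 2 + (n + 1))) := isUnit_one.neg.pow _
  refine hreg.left (hunit.mul_left_cancel ?_)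
  linear_combination -hres_f

theorem discr_X_sub_C_mul (a : R) {h : R[X]} (hpos : 0 < h.natDegree) :
    ((X - C a) * h).discr = h.eval a ^ 2 * h.discr := by
  nontriviality R
  -- Deform `h` so that its leading coefficient becomes regular, then specialise back at `0`.
  let H : R[X][X] := h.map C + C X * X ^ h.natDegree
  have hcoeff : H.coeff h.natDegree = X + C h.leadingCoeff := by
    simp [H, add_comm]
  have hdeg : H.natDegree = h.natDegree := by
    refine le_antisymm (natDegree_add_le_of_degree_le natDegree_map_le
      (natDegree_C_mul_X_pow_le _ _)) (le_natDegree_of_ne_zero ?_)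
    rw [hcoeff]
    exact (monic_X_add_C _).ne_zero
  have hreg : IsRegular H.leadingCoeff := by
    rw [leadingCoeff, hdeg, hcoeff]
    exact (monic_X_add_C _).isRegular
  have hmap : H.map (evalRingHom 0) = h := by
    ext i
    simp [H, Polynomial.map_map]
  have hne : h ≠ 0 := ne_zero_of_natDegree_gt hpos
  have hneH : H ≠ 0 := ne_zero_of_natDegree_gt (hdeg ▸ hpos)
  have hmap_mul : ((X - C (C a)) * H).map (evalRingHom 0) = (X - C a) * h := by
    simp [Polynomial.map_mul, hmap]
  have heval : evalRingHom 0 (H.eval (C a)) = h.eval a := by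
    rw [← eval_map_apply, hmap]
    simp
  calc ((X - C a) * h).discr = evalRingHom 0 ((X - C (C a)) * H).discr := by
        rw [← hmap_mul, discr_map_of_natDegree_eq]
        rw [hmap_mul, natDegree_X_sub_C_mul _ hne, natDegree_X_sub_C_mul _ hneH, hdeg]
    _ = h.eval a ^ 2 * evalRingHom 0 H.discr := by
        rw [discr_X_sub_C_mul_of_isRegular (C a) (hdeg ▸ hpos) hreg, map_mul, map_pow, heval]
    _ = h.eval a ^ 2 * h.discr := by
        rw [← discr_map_of_natDegree_eq _ (by rw [hmap, hdeg]), hmap]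

theorem C_discr_mem_span_derivative_sq_self {f : R[X]} (hdeg : 2 ≤ f.natDegree) :
    C f.discr ∈ Ideal.span {f.derivative ^ 2, f} := by
  nontriviality R
  let g : R[X][X] := f.map C - C f
  have hg_discr : f ∣ C f.discr - g.discr := by
    have hmap : (f.map (C : R →+* R[X])).natDegree = f.natDegree :=
      natDegree_map_eq_of_injective C_injective f
    have := dvd_discr_add_C_sub_discr (f.map C) (-f)
    rwa [neg_dvd, ← dvd_neg, neg_sub, C_neg, ← sub_eq_add_neg,
      discr_map_of_natDegree_eq _ hmap] at this
  obtain ⟨h, hgh⟩ : X - C X ∣ g := dvd_iff_isRoot.2 (by simp [g, IsRoot, eval_map, eval₂_C_X])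
  have hg_deg : g.natDegree = f.natDegree := by
    rw [natDegree_sub_C, natDegree_map_eq_of_injective C_injective]
  have hpos : 0 < h.natDegree := by
    have hne : h ≠ 0 := by
      rintro rfl
      rw [hgh, mul_zero, natDegree_zero] at hg_deg
      lia
    have hdeg_mul := natDegree_X_sub_C_mul X hne
    rw [← hgh] at hdeg_mul
    lia
  have heval : h.eval X = f.derivative := by
    have := congr(eval X (derivative $hgh))
    simpa [g, derivative_map, eval_map, eval₂_C_X] using this.symm
  have hsq : f.derivative ^ 2 ∣ g.discr := by
    rw [hgh, discr_X_sub_C_mul X hpos, heval]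
    exact dvd_mul_right _ _
  rw [← sub_add_cancel (C f.discr) g.discr]
  exact add_mem (Ideal.mem_of_dvd _ hg_discr (Ideal.subset_span (by simp)))
    (Ideal.mem_of_dvd _ hsq (Ideal.subset_span (by simp)))

theorem sq_eval₂_derivative_dvd_map_discr (φ : R →+* S) {f : R[X]} (hdeg : 2 ≤ f.natDegree)
    {a : S} (ha : f.eval₂ φ a = 0) : f.derivative.eval₂ φ a ^ 2 ∣ φ f.discr := by
  obtain ⟨u, v, huv⟩ := Ideal.mem_span_pair.1 (C_discr_mem_span_derivative_sq_self hdeg)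
  refine ⟨u.eval₂ φ a, ?_⟩
  simpa [ha, eval₂_mul, eval₂_add, eval₂_pow, mul_comm] using congr(eval₂ φ a $huv.symm)

end Discriminant

section HahnSeries

variable {Γ R : Type*} [AddCommGroup Γ] [PartialOrder Γ] [IsOrderedAddMonoid Γ] [CommRing R]

theorem support_coeff_mul_coeff_sub_subset (x y : HahnSeries Γ R) (q : Γ) :
    (fun p => x.coeff p * y.coeff (q - p)).support ⊆
      Prod.fst '' (Finset.antidiagonal x.isPWO_support y.isPWO_support q : Set (Γ × Γ)) :=
  fun p hp => ⟨(p, q - p), Finset.mem_coe.2 (Finset.mem_antidiagonal.2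
    ⟨left_ne_zero_of_mul hp, right_ne_zero_of_mul hp, add_sub_cancel p q⟩), rfl⟩

theorem hasFiniteSupport_coeff_mul_coeff_sub (x y : HahnSeries Γ R) (q : Γ) :
    (fun p => x.coeff p * y.coeff (q - p)).HasFiniteSupport :=
  ((Finset.finite_toSet _).image _).subset (support_coeff_mul_coeff_sub_subset x y q)

theorem coeff_mul_eq_finsum (x y : HahnSeries Γ R) (q : Γ) :
    (x * y).coeff q = ∑ᶠ p, x.coeff p * y.coeff (q - p) := by
  classical
  have hsnd {ij : Γ × Γ} (h : ij ∈ Finset.antidiagonal x.isPWO_support y.isPWO_support q) :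
      ij.2 = q - ij.1 := eq_sub_of_add_eq' (Finset.mem_antidiagonal.1 h).2.2
  rw [HahnSeries.coeff_mul, finsum_eq_finsetSum_of_support_subset _
    ((support_coeff_mul_coeff_sub_subset x y q).trans (Finset.coe_image ..).ge), Finset.sum_image]
  · exact Finset.sum_congr rfl fun ij h => by rw [hsnd h]
  · exact fun ij h ij' h' heq => Prod.ext heq (by rw [hsnd h, hsnd h', heq])

end HahnSeries

section Substitution

variable {R S : Type*} [CommRing R] [CommRing S]

theorem FracPowerSeries.ext {a b : FracPowerSeries R}
    (h : ∀ q, (a : HahnSeries ℚ R).coeff q = (b : HahnSeries ℚ R).coeff q) : a = b :=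
  Subtype.ext (HahnSeries.ext (funext h))

theorem coe_fracC (r : R) : (fracC r : HahnSeries ℚ R) = HahnSeries.single 0 r := rfl

theorem coeff_fracMap (f : R →+* S) (a : FracPowerSeries R) (q : ℚ) :
    (fracMap f a : HahnSeries ℚ S).coeff q = f ((a : HahnSeries ℚ R).coeff q) := rfl

theorem coeff_fracSubst (U : FracPowerSeries R) (Φ : FracPowerSeries R[X]) (q : ℚ) :
    (fracSubst U Φ : HahnSeries ℚ R).coeff q =
      ∑ᶠ p, (fracEval U ((Φ : HahnSeries ℚ R[X]).coeff p) : HahnSeries ℚ R).coeff (q - p) := by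
  change (substFamily U Φ).hsum.coeff q = _
  rw [HahnSeries.SummableFamily.coeff_hsum]
  refine finsum_congr fun p => ?_
  change (HahnSeries.single p (1 : R) * _).coeff q = _
  rw [HahnSeries.coeff_single_mul, one_mul]

theorem fracSubst_mul (U : FracPowerSeries R) (Φ Ψ : FracPowerSeries R[X]) :
    fracSubst U (Φ * Ψ) = fracSubst U Φ * fracSubst U Ψ := by
  let evalCoeff (r : ℚ) : R[X] →+ R := (HahnSeries.coeff.addMonoidHom r).comp
    ((FracPowerSeries R).subtype.comp (eval₂RingHom fracC U)).toAddMonoidHom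
  let pairs := (substFamily U Φ).mul (substFamily U Ψ)
  let e : ℚ × ℚ ≃ ℚ × ℚ :=
    { toFun x := (x.2, x.1 - x.2)
      invFun x := (x.1 + x.2, x.1)
      left_inv x := by simp
      right_inv x := by simp }
  have hpairs (r p q : ℚ) : (pairs (e (r, p))).coeff q = evalCoeff (q - r)
      ((Φ : HahnSeries ℚ R[X]).coeff p * (Ψ : HahnSeries ℚ R[X]).coeff (r - p)) := by
    change (HahnSeries.single p (1 : R) * _ * (HahnSeries.single (r - p) 1 * _)).coeff q = _
    rw [mul_mul_mul_comm, HahnSeries.single_mul_single, HahnSeries.coeff_single_mul, add_sub_cancel,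
      one_mul, one_mul]
    rw [← Subring.coe_mul, fracEval, fracEval, ← eval₂_mul]
    rfl
  have hfin (q : ℚ) : (fun x => (pairs (e x)).coeff q).HasFiniteSupport :=
    (pairs.finite_co_support q).preimage e.injective.injOn
  refine FracPowerSeries.ext fun q => ?_
  calc (fracSubst U (Φ * Ψ) : HahnSeries ℚ R).coeff q
      = ∑ᶠ r, evalCoeff (q - r) (((Φ : HahnSeries ℚ R[X]) * Ψ).coeff r) := coeff_fracSubst ..
    _ = ∑ᶠ (r) (p), (pairs (e (r, p))).coeff q := by
        refine finsum_congr fun r => ?_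
        rw [coeff_mul_eq_finsum, map_finsum _ (hasFiniteSupport_coeff_mul_coeff_sub _ _ r)]
        exact finsum_congr fun p => (hpairs r p q).symm
    _ = ∑ᶠ x, (pairs x).coeff q := by
        rw [← finsum_comp_equiv e, finsum_curry _ (hfin q)]
    _ = ((fracSubst U Φ * fracSubst U Ψ : FracPowerSeries R) : HahnSeries ℚ R).coeff q := by
        rw [← HahnSeries.SummableFamily.coeff_hsum, HahnSeries.SummableFamily.hsum_mul]
        rfl

theorem fracSubst_add (U : FracPowerSeries R) (Φ Ψ : FracPowerSeries R[X]) :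
    fracSubst U (Φ + Ψ) = fracSubst U Φ + fracSubst U Ψ := by
  refine Subtype.ext ?_
  change (substFamily U (Φ + Ψ)).hsum = (substFamily U Φ).hsum + (substFamily U Ψ).hsum
  rw [← HahnSeries.SummableFamily.hsum_add]
  congr 1
  ext1 p
  change HahnSeries.single p 1 * (fracEval U (_ + _) : HahnSeries ℚ R) = _ * _ + _ * _
  rw [← mul_add, fracEval, eval₂_add]
  rfl

theorem fracSubst_fracC (U : FracPowerSeries R) (φ : R[X]) :
    fracSubst U (fracC φ) = fracEval U φ := by
  refine FracPowerSeries.ext fun q => ?_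
  rw [coeff_fracSubst, finsum_eq_single _ 0]
  · simp [coe_fracC]
  · intro p hp
    simp [coe_fracC, HahnSeries.coeff_single_of_ne hp, fracEval]

theorem fracSubst_fracMap_C (U b : FracPowerSeries R) : fracSubst U (fracMap C b) = b := by
  refine FracPowerSeries.ext fun q => ?_
  simp only [coeff_fracSubst, coeff_fracMap, fracEval, eval₂_C, coe_fracC]
  rw [finsum_eq_single _ q fun p hp => HahnSeries.coeff_single_of_ne (sub_ne_zero.2 hp.symm)]
  simp

/-- The substitution `Φ ↦ Φ(t,U)` as a ring homomorphism. -/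
def fracSubstHom (U : FracPowerSeries R) : FracPowerSeries R[X] →+* FracPowerSeries R where
  toFun := fracSubst U
  map_one' := by
    rw [← map_one (fracC : R[X] →+* _), fracSubst_fracC, fracEval, eval₂_one]
  map_mul' := fracSubst_mul U
  map_zero' := by
    rw [← map_zero (fracC : R[X] →+* _), fracSubst_fracC, fracEval, eval₂_zero]
  map_add' := fracSubst_add U

theorem fracSubstHom_apply (U : FracPowerSeries R) (Φ : FracPowerSeries R[X]) :
    fracSubstHom U Φ = fracSubst U Φ := rfl

/-- Applying a ring homomorphism to every coefficient, as a ring homomorphism. -/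
def fracMapHom (f : R →+* S) : FracPowerSeries R →+* FracPowerSeries S where
  toFun := fracMap f
  map_one' := FracPowerSeries.ext fun q => by
    simp [coeff_fracMap, HahnSeries.coeff_one, apply_ite f]
  map_mul' _ _ := Subtype.ext (HahnSeries.map_mul (f : R →ₙ+* S))
  map_zero' := FracPowerSeries.ext fun q => by simp [coeff_fracMap]
  map_add' _ _ := FracPowerSeries.ext fun q => by simp [coeff_fracMap]

@[simp]
theorem fracMapHom_apply (f : R →+* S) (a : FracPowerSeries R) :
    fracMapHom f a = fracMap f a := rfl

variable (R) in
/-- The inclusion `R^fr[[t]][u] ⊆ R[u]^fr[[t]]`. -/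
def fracOfPoly : (FracPowerSeries R)[X] →+* FracPowerSeries R[X] :=
  eval₂RingHom (fracMapHom C) (fracC X)

@[simp]
theorem fracOfPoly_C (b : FracPowerSeries R) : fracOfPoly R (C b) = fracMap C b := by
  simp [fracOfPoly]

@[simp]
theorem fracOfPoly_X : fracOfPoly R X = fracC X := by
  simp [fracOfPoly]

/-- The Hasse derivative of order `j` in `u`, applied to every coefficient: the operator
`(1 / j!) (∂/∂u)^j` of `R[u]^fr[[t]]`, defined in every characteristic. -/
def fracHasseDeriv (j : ℕ) : FracPowerSeries R[X] →+ FracPowerSeries R[X] where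
  toFun Φ := ⟨HahnSeries.map (Φ : HahnSeries ℚ R[X]) (hasseDeriv j : R[X] →ₗ[R] R[X]), by
    obtain ⟨d, hd, hΦ⟩ := Φ.2
    exact ⟨d, hd, fun q hq => hΦ fun h0 => hq (by simp [h0])⟩⟩
  map_zero' := FracPowerSeries.ext fun q => by simp
  map_add' _ _ := FracPowerSeries.ext fun q => by simp

theorem coeff_fracHasseDeriv (j : ℕ) (Φ : FracPowerSeries R[X]) (q : ℚ) :
    (fracHasseDeriv j Φ : HahnSeries ℚ R[X]).coeff q =
      hasseDeriv j ((Φ : HahnSeries ℚ R[X]).coeff q) := rfl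

theorem fracHasseDeriv_zero (Φ : FracPowerSeries R[X]) : fracHasseDeriv 0 Φ = Φ :=
  FracPowerSeries.ext fun q => by simp [coeff_fracHasseDeriv]

theorem fracHasseDeriv_mul (n : ℕ) (Φ Ψ : FracPowerSeries R[X]) :
    fracHasseDeriv n (Φ * Ψ) =
      ∑ ij ∈ Finset.HasAntidiagonal.antidiagonal n,
        fracHasseDeriv ij.1 Φ * fracHasseDeriv ij.2 Ψ := by
  refine FracPowerSeries.ext fun q => ?_
  rw [coeff_fracHasseDeriv, Subring.coe_mul, coeff_mul_eq_finsum,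
    map_finsum _ (hasFiniteSupport_coeff_mul_coeff_sub _ _ q)]
  simp only [hasseDeriv_mul, AddSubmonoidClass.coe_finsetSum, Subring.coe_mul,
    HahnSeries.coeff_sum, coeff_mul_eq_finsum, coeff_fracHasseDeriv]
  exact finsum_sum_comm _ _ fun ij _ => hasFiniteSupport_coeff_mul_coeff_sub
    (fracHasseDeriv ij.1 Φ : HahnSeries ℚ R[X]) (fracHasseDeriv ij.2 Ψ) q

theorem fracHasseDeriv_fracMap_C (j : ℕ) (b : FracPowerSeries R) :
    fracHasseDeriv j (fracMap C b) = if j = 0 then fracMap C b else 0 := by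
  refine FracPowerSeries.ext fun q => ?_
  rw [coeff_fracHasseDeriv]
  obtain rfl | hj := eq_or_ne j 0
  · simp
  · simp [hj, coeff_fracMap, hasseDeriv_C _ _ (Nat.pos_of_ne_zero hj)]

theorem fracHasseDeriv_fracC (j : ℕ) (φ : R[X]) :
    fracHasseDeriv j (fracC φ) = fracC (hasseDeriv j φ) := by
  refine FracPowerSeries.ext fun q => ?_
  obtain rfl | hq := eq_or_ne q 0
  · simp [coeff_fracHasseDeriv, coe_fracC]
  · simp [coeff_fracHasseDeriv, coe_fracC, HahnSeries.coeff_single_of_ne hq]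

/-- The Taylor expansion `Φ(t, U + ε) ∈ R^fr[[t]][[ε]]` of `Φ(t,u) ∈ R[u]^fr[[t]]` at `u = U`. -/
def fracTaylor (U : FracPowerSeries R) :
    FracPowerSeries R[X] →+* PowerSeries (FracPowerSeries R) where
  toFun Φ := PowerSeries.mk fun j => fracSubstHom U (fracHasseDeriv j Φ)
  map_one' := by
    ext1 j
    rw [← map_one (fracMapHom (C : R →+* R[X])), fracMapHom_apply, PowerSeries.coeff_mk,
      fracHasseDeriv_fracMap_C, PowerSeries.coeff_one, apply_ite (fracSubstHom U), map_zero,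
      fracSubstHom_apply, fracSubst_fracMap_C]
  map_mul' Φ Ψ := by
    ext1 j
    simp only [PowerSeries.coeff_mk, PowerSeries.coeff_mul, fracHasseDeriv_mul, map_sum, map_mul]
  map_zero' := by
    ext1 j
    simp
  map_add' Φ Ψ := by
    ext1 j
    simp

theorem coeff_fracTaylor (U : FracPowerSeries R) (j : ℕ) (Φ : FracPowerSeries R[X]) :
    PowerSeries.coeff j (fracTaylor U Φ) = fracSubst U (fracHasseDeriv j Φ) :=
  PowerSeries.coeff_mk j fun j => fracSubstHom U (fracHasseDeriv j Φ)

theorem fracTaylor_fracMap_C (U b : FracPowerSeries R) :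
    fracTaylor U (fracMap C b) = PowerSeries.C b := by
  ext1 j
  rw [coeff_fracTaylor, fracHasseDeriv_fracMap_C, PowerSeries.coeff_C, ← fracSubstHom_apply,
    apply_ite (fracSubstHom U), map_zero, fracSubstHom_apply, fracSubst_fracMap_C]

theorem fracTaylor_fracC_X (U : FracPowerSeries R) :
    fracTaylor U (fracC X) = PowerSeries.X + PowerSeries.C U := by
  ext1 j
  rw [coeff_fracTaylor, fracHasseDeriv_fracC, fracSubst_fracC, fracEval]
  match j with
  | 0 => simp
  | 1 => simp
  | j + 2 => simp [PowerSeries.coeff_X, hasseDeriv_X]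

theorem fracTaylor_fracOfPoly (U : FracPowerSeries R) (Q : (FracPowerSeries R)[X]) :
    fracTaylor U (fracOfPoly R Q) = (taylor U Q : (FracPowerSeries R)[X]) := by
  suffices h : (fracTaylor U).comp (fracOfPoly R) =
      coeToPowerSeries.ringHom.comp (taylorAlgHom U : _ →+* (FracPowerSeries R)[X]) from congr($h Q)
  refine Polynomial.ringHom_ext (fun b => ?_) ?_
  · simp [fracTaylor_fracMap_C]
  · simp [fracTaylor_fracC_X]

theorem X_pow_dvd_fracTaylor_fracOfPoly_iff {U : FracPowerSeries R} {m : ℕ}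
    {Q : (FracPowerSeries R)[X]} :
    PowerSeries.X ^ m ∣ fracTaylor U (fracOfPoly R Q) ↔ (X - C U) ^ m ∣ Q := by
  rw [fracTaylor_fracOfPoly, X_sub_C_pow_dvd_iff, ← taylor_apply, PowerSeries.X_pow_dvd_iff,
    Polynomial.X_pow_dvd_iff]
  simp only [coeff_coe]

theorem X_dvd_fracTaylor_iff {U : FracPowerSeries R} {Φ : FracPowerSeries R[X]} :
    PowerSeries.X ∣ fracTaylor U Φ ↔ fracSubst U Φ = 0 := by
  rw [PowerSeries.X_dvd_iff, ← PowerSeries.coeff_zero_eq_constantCoeff_apply, coeff_fracTaylor,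
    fracHasseDeriv_zero]

theorem X_pow_dvd_fracTaylor_of_pow_dvd {U : FracPowerSeries R} {m : ℕ} {Φ : FracPowerSeries R[X]}
    (h : (fracC X - fracMap C U) ^ m ∣ Φ) : PowerSeries.X ^ m ∣ fracTaylor U Φ := by
  simpa [fracTaylor_fracC_X, fracTaylor_fracMap_C] using map_dvd (fracTaylor U) h

theorem X_sub_C_pow_two_mul_dvd_of_sq_dvd {U : FracPowerSeries R} {l : ℕ}
    {Φ : FracPowerSeries R[X]} {Q : (FracPowerSeries R)[X]}
    (hΦ : PowerSeries.X ^ l ∣ fracTaylor U Φ) (hQ : Φ ^ 2 ∣ fracOfPoly R Q) :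
    (X - C U) ^ (2 * l) ∣ Q := by
  rw [← X_pow_dvd_fracTaylor_fracOfPoly_iff, mul_comm, pow_mul]
  exact (pow_dvd_pow_of_dvd hΦ 2).trans (by simpa using map_dvd (fracTaylor U) hQ)

end Substitution

section Coefficients

variable {R S : Type*} [CommRing R] [CommRing S]

theorem fracOfPowerSeries_C (r : R) : fracOfPowerSeries (PowerSeries.C r) = fracC r :=
  Subtype.ext (HahnSeries.ofPowerSeries_C r)

theorem fracMap_fracC (f : R →+* S) (r : R) : fracMap f (fracC r) = fracC (f r) :=
  Subtype.ext (HahnSeries.map_C r f)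

theorem fracMap_fracOfPowerSeries (f : R →+* S) (p : PowerSeries R) :
    fracMap f (fracOfPowerSeries p) = fracOfPowerSeries (PowerSeries.map f p) := by
  refine FracPowerSeries.ext fun q => ?_
  change f ((HahnSeries.ofPowerSeries ℚ R p).coeff q) =
    (HahnSeries.ofPowerSeries ℚ S (PowerSeries.map f p)).coeff q
  by_cases hq : q ∈ Set.range ((↑) : ℕ → ℚ)
  · obtain ⟨n, rfl⟩ := hq
    simp only [HahnSeries.ofPowerSeries_apply_coeff, PowerSeries.coeff_map]
  · rw [HahnSeries.ofPowerSeries_apply, HahnSeries.ofPowerSeries_apply,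
      HahnSeries.embDomain_of_notMem_range hq, HahnSeries.embDomain_of_notMem_range hq, map_zero]

end Coefficients

section Polynomials

theorem derivative_eval₂_C_comp {σ R A : Type*} [DecidableEq σ] [CommSemiring R] [CommSemiring A]
    (f : R →+* A) {x : σ → A[X]} {j : σ}
    (hx : ∀ i, derivative (x i) = (Pi.single j 1 : σ → A[X]) i)
    (Q : MvPolynomial σ R) :
    derivative (Q.eval₂ (C.comp f) x) = (MvPolynomial.pderiv j Q).eval₂ (C.comp f) x := by
  induction Q using MvPolynomial.induction_on with
  | C a => simp
  | add p q hp hq => simp [hp, hq]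
  | mul_X p i hp =>
    have hX : MvPolynomial.eval₂ (C.comp f) x ((Pi.single j 1 : σ → MvPolynomial σ R) i) =
        (Pi.single j 1 : σ → A[X]) i := by
      obtain rfl | hij := eq_or_ne i j <;> simp [*]
    simp only [Derivation.leibniz, derivative_mul, MvPolynomial.eval₂_mul, MvPolynomial.eval₂_add,
      MvPolynomial.eval₂_X, MvPolynomial.pderiv_X, smul_eq_mul, hp, hx, hX]
    ring

theorem finSuccEquiv_pderiv_zero {R : Type*} [CommSemiring R] (n : ℕ)
    (P : MvPolynomial (Fin (n + 1)) R) :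
    MvPolynomial.finSuccEquiv R n (MvPolynomial.pderiv 0 P) =
      derivative (MvPolynomial.finSuccEquiv R n P) := by
  have heq (Q : MvPolynomial (Fin (n + 1)) R) : MvPolynomial.finSuccEquiv R n Q =
      Q.eval₂ (C.comp MvPolynomial.C) (Fin.cases X fun i => C (MvPolynomial.X i)) :=
    congr($(MvPolynomial.finSuccEquiv_eq (R := R) (n := n)) Q)
  rw [heq, heq]
  exact (derivative_eval₂_C_comp _ (Fin.cases (by simp) (by simp)) P).symm

theorem eval₂_finSuccEquiv {R A : Type*} [CommSemiring R] [CommSemiring A] {n : ℕ}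
    (ψ : MvPolynomial (Fin n) R →+* A) (y : A) (Q : MvPolynomial (Fin (n + 1)) R) :
    (MvPolynomial.finSuccEquiv R n Q).eval₂ ψ y =
      Q.eval₂ (ψ.comp MvPolynomial.C) (Fin.cons y fun i => ψ (MvPolynomial.X i)) := by
  change (eval₂RingHom ψ y).comp (MvPolynomial.finSuccEquiv R n : _ →+* _) Q =
    MvPolynomial.eval₂Hom _ _ Q
  congr 1
  refine MvPolynomial.ringHom_ext (fun a => ?_) (Fin.cases ?_ fun i => ?_)
  · simp [MvPolynomial.finSuccEquiv_apply]
  · simp [MvPolynomial.finSuccEquiv_X_zero]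
  · simp [MvPolynomial.finSuccEquiv_X_succ]

end Polynomials

section Evaluation

variable {K : Type*} [Field K] {k : ℕ}

theorem map_paramPoint {A B : Type*} (φ : A → B) (x : Fin k → A) (t v : A) :
    (fun i => φ (paramPoint x t v i)) = paramPoint (fun i => φ (x i)) (φ t) (φ v) := by
  simp only [paramPoint, ← Function.comp_def φ, Fin.comp_snoc]

theorem map_fullPoint {A B : Type*} (φ : A → B) (x₀ : A) (x : Fin k → A) (t v : A) :
    (fun i => φ (fullPoint x₀ x t v i)) = fullPoint (φ x₀) (fun i => φ (x i)) (φ t) (φ v) := by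
  rw [fullPoint, fullPoint, ← map_paramPoint]
  exact Fin.comp_cons ..

theorem eval_evalParamPoly (D : MvPolynomial (Fin (k + 2)) K) (Fs : Fin k → PowerSeries K)
    (U : FracPowerSeries (AlgebraicClosure K)) :
    (evalParamPoly D Fs).eval U = evalParam D Fs U := by
  rw [evalParamPoly, evalParam, ← coe_evalRingHom, MvPolynomial.hom_eval₂, map_paramPoint]
  congr 1
  · ext; simp
  · simp

theorem derivative_evalParamPoly (D : MvPolynomial (Fin (k + 2)) K) (Fs : Fin k → PowerSeries K) :
    derivative (evalParamPoly D Fs) = evalParamPoly (derivV D) Fs := by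
  refine derivative_eval₂_C_comp constK (fun i => ?_) D
  cases i using Fin.lastCases with
  | last => simp [paramPoint]
  | cast i => cases i using Fin.lastCases <;> simp [paramPoint, (Fin.castSucc_lt_last _).ne]

theorem iterate_derivative_evalParamPoly (D : MvPolynomial (Fin (k + 2)) K)
    (Fs : Fin k → PowerSeries K) (i : ℕ) :
    derivative^[i] (evalParamPoly D Fs) = evalParamPoly (derivV^[i] D) Fs := by
  induction i with
  | zero => rfl
  | succ i ih =>
    rw [Function.iterate_succ_apply', Function.iterate_succ_apply', ih, derivative_evalParamPoly]

theorem evalParam_iterate_derivV_eq_zero {D : MvPolynomial (Fin (k + 2)) K}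
    {Fs : Fin k → PowerSeries K} {U : FracPowerSeries (AlgebraicClosure K)} {m i : ℕ}
    (h : (X - C U) ^ m ∣ evalParamPoly D Fs) (hi : i < m) :
    evalParam (derivV^[i] D) Fs U = 0 := by
  rw [← eval_evalParamPoly, ← iterate_derivative_evalParamPoly, ← IsRoot.def, ← dvd_iff_isRoot]
  exact (dvd_pow_self _ (Nat.sub_pos_of_lt hi).ne').trans
    (pow_sub_dvd_iterate_derivative_of_pow_dvd i h)

theorem seriesKu_C_C (a : K) : seriesKu (PowerSeries.C (C a)) = fracMap C (constK a) := by
  simp [constK, seriesKu, fracMap_fracC, fracOfPowerSeries_C]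

theorem seriesKu_C_X :
    seriesKu (PowerSeries.C (X : K[X])) = fracC (X : (AlgebraicClosure K)[X]) := by
  simp [seriesKu, fracOfPowerSeries_C]

theorem seriesKu_map_C (f : PowerSeries K) :
    seriesKu (PowerSeries.map C f) = fracMap C (seriesK f) := by
  simp only [seriesK, seriesKu, RingHom.comp_apply, fracMap_fracOfPowerSeries]
  congr 1
  ext1 n
  simp

theorem seriesKu_evalSeries (Q : MvPolynomial (Fin (k + 3)) K) (F : PowerSeries K[X])
    (Fs : Fin k → PowerSeries K) :
    seriesKu (evalSeries Q F Fs) =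
      Q.eval₂ ((fracMapHom C).comp constK)
        (fullPoint (seriesKu F) (fun i => fracMap C (seriesK (Fs i)))
          (fracMap C (seriesK PowerSeries.X)) (fracC X)) := by
  rw [evalSeries, MvPolynomial.hom_eval₂, map_fullPoint, ← PowerSeries.map_X (C : K →+* K[X]),
    seriesKu_map_C, seriesKu_C_X]
  congr 1
  · ext1 a
    exact seriesKu_C_C a
  · simp only [seriesKu_map_C]

theorem fracSubst_seriesKu_evalSeries (Q : MvPolynomial (Fin (k + 3)) K) (F : PowerSeries K[X])
    (Fs : Fin k → PowerSeries K) (U : FracPowerSeries (AlgebraicClosure K)) :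
    fracSubst U (seriesKu (evalSeries Q F Fs)) =
      evalFull Q (fracSubst U (seriesKu F)) Fs U := by
  rw [seriesKu_evalSeries, evalFull, ← fracSubstHom_apply, MvPolynomial.hom_eval₂, map_fullPoint]
  congr 1
  · ext1 a
    exact fracSubst_fracMap_C U (constK a)
  · simp [fracSubstHom_apply, fracSubst_fracMap_C, fracSubst_fracC, fracEval]

/-- The substitution `D ↦ D(F_1, …, F_k, t, u) ∈ K̄[u]^fr[[t]]` as a ring homomorphism. -/
def evalParamHom (Fs : Fin k → PowerSeries K) :
    MvPolynomial (Fin (k + 2)) K →+* FracPowerSeries (AlgebraicClosure K)[X] :=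
  (fracOfPoly (AlgebraicClosure K)).comp (MvPolynomial.eval₂Hom (C.comp constK)
    (paramPoint (fun i => C (seriesK (Fs i))) (C (seriesK PowerSeries.X)) X))

theorem evalParamHom_apply (Fs : Fin k → PowerSeries K) (D : MvPolynomial (Fin (k + 2)) K) :
    evalParamHom Fs D = fracOfPoly (AlgebraicClosure K) (evalParamPoly D Fs) := rfl

theorem eval₂_evalParamHom_finSuccEquiv (Q : MvPolynomial (Fin (k + 3)) K) (F : PowerSeries K[X])
    (Fs : Fin k → PowerSeries K) :
    (MvPolynomial.finSuccEquiv K (k + 2) Q).eval₂ (evalParamHom Fs) (seriesKu F) =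
      seriesKu (evalSeries Q F Fs) := by
  rw [eval₂_finSuccEquiv, seriesKu_evalSeries]
  congr 1
  · ext1 a
    simp [evalParamHom]
  · simp only [fullPoint, evalParamHom, RingHom.comp_apply, MvPolynomial.eval₂Hom_X',
      map_paramPoint (fracOfPoly (AlgebraicClosure K)), fracOfPoly_C, fracOfPoly_X]

theorem sq_seriesKu_evalSeries_pderiv_dvd {P : MvPolynomial (Fin (k + 3)) K} {F : PowerSeries K[X]}
    {Fs : Fin k → PowerSeries K} (hF : evalSeries P F Fs = 0)
    (hdeg : 2 ≤ MvPolynomial.degreeOf 0 P) :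
    seriesKu (evalSeries (MvPolynomial.pderiv 0 P) F Fs) ^ 2 ∣
      fracOfPoly (AlgebraicClosure K) (evalParamPoly (discr₀ P) Fs) := by
  rw [← eval₂_evalParamHom_finSuccEquiv, finSuccEquiv_pderiv_zero, ← evalParamHom_apply]
  refine sq_eval₂_derivative_dvd_map_discr _ ?_ ?_
  · rwa [MvPolynomial.natDegree_finSuccEquiv]
  · rw [eval₂_evalParamHom_finSuccEquiv, hF, map_zero]

end Evaluation

end

theorem mainTheorem2_general {K : Type*} [Field K] (k : ℕ) (P : MvPolynomial (Fin (k + 3)) K)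
    (F : PowerSeries (Polynomial K)) (Fs : Fin k → PowerSeries K)
    (hF : evalSeries P F Fs = 0) (hdeg : 2 ≤ MvPolynomial.degreeOf 0 P)
    (U : FracPowerSeries (AlgebraicClosure K)) :
    (∀ l : ℕ, (fracC Polynomial.X - fracMap Polynomial.C U) ^ l ∣
          seriesKu (evalSeries (MvPolynomial.pderiv 0 P) F Fs) →
        (Polynomial.X - Polynomial.C U) ^ (2 * l) ∣ evalParamPoly (discr₀ P) Fs ∧
        ∀ i < 2 * l, evalParam (derivV^[i] (discr₀ P)) Fs U = 0) ∧
    (evalFull (MvPolynomial.pderiv 0 P) (fracSubst U (seriesKu F)) Fs U = 0 →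
      evalParam (discr₀ P) Fs U = 0 ∧ evalParam (derivV (discr₀ P)) Fs U = 0) := by
  have hdvd := sq_seriesKu_evalSeries_pderiv_dvd hF hdeg
  refine ⟨fun l hl => ?_, fun hU => ?_⟩
  · have hroot := X_sub_C_pow_two_mul_dvd_of_sq_dvd (X_pow_dvd_fracTaylor_of_pow_dvd hl) hdvd
    exact ⟨hroot, fun i hi => evalParam_iterate_derivV_eq_zero hroot hi⟩
  · rw [← fracSubst_seriesKu_evalSeries, ← X_dvd_fracTaylor_iff, ← pow_one PowerSeries.X] at hU
    have hroot := X_sub_C_pow_two_mul_dvd_of_sq_dvd hU hdvd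
    exact ⟨evalParam_iterate_derivV_eq_zero (i := 0) hroot two_pos,
      evalParam_iterate_derivV_eq_zero (i := 1) hroot one_lt_two⟩

theorem mainTheorem2 {K : Type*} [Field K] [CharZero K] (k : ℕ)
    (P : MvPolynomial (Fin (k + 3)) K)
    (F : PowerSeries (Polynomial K)) (Fs : Fin k → PowerSeries K)
    (hF : evalSeries P F Fs = 0)
    (hdeg : 2 ≤ MvPolynomial.degreeOf 0 P) :
    (∀ (U : FracPowerSeries (AlgebraicClosure K)) (l : ℕ), 1 ≤ l →
      IsRootOfMultiplicity U l (seriesKu (evalSeries (MvPolynomial.pderiv 0 P) F Fs)) →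
        (Polynomial.X - Polynomial.C U) ^ (2 * l) ∣ evalParamPoly (discr₀ P) Fs ∧
        ∀ i < 2 * l, evalParam (derivV^[i] (discr₀ P)) Fs U = 0) ∧
    (∀ U : Fin k → FracPowerSeries (AlgebraicClosure K),
      (∀ i, evalFull (MvPolynomial.pderiv 0 P) (fracSubst (U i) (seriesKu F)) Fs (U i) = 0) →
        ∀ i, evalParam (discr₀ P) Fs (U i) = 0 ∧
          evalParam (derivV (discr₀ P)) Fs (U i) = 0) := by
  have general := mainTheorem2_general k P F Fs hF hdeg
  exact ⟨fun U l _ ⟨Ψ, hΨ, _⟩ => (general U).1 l ⟨Ψ, hΨ⟩, fun U hU i => (general (U i)).2 (hU i)⟩
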